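/- Let $\Psi$ be an infinite set and let $\mathfrak S_\Psi$ be the group of all permutations of $\Psi$, with the topology generated by the left translates of the stabilizers of the elements of $\Psi$. For a finite subset $T\subset\Psi$ let $\mathfrak S_{\Psi|T}$ be the pointwise stabilizer of $T$ in $\mathfrak S_\Psi$. An action of $\mathfrak S_\Psi$ on a set is called smooth if the stabilizers of all elements are open. For a field $K$ with an action of $\mathfrak S_\Psi$ by field automorphisms, a $K$-semilinear representation of $\mathfrak S_\Psi$ is a $K$-vector space $V$ with an additive action of $\mathfrak S_\Psi$ such that $g(av)=g(a)\,g(v)$ for all $g\in\mathfrak S_\Psi$, $a\in K$, $v\in V$; it is finitely generated if it is spanned over $K$ by the $\mathfrak S_\Psi$-translates of finitely many vectors, i.e. if it is a finitely generated module over the skew group ring $K\langle\mathfrak S_\Psi\rangle$. Let $K$ be a field endowed with a smooth non-trivial action of $\mathfrak S_\Psi$ by field automorphisms, and let $V$ be a smooth finitely generated $K$-semilinear representation of $\mathfrak S_\Psi$. Then there is a unique polynomial $P_V\in\mathbb Q[X]$ for which there exists an integer $n\ge 0$ such that, for every finite subset $T\subset\Psi$ with $\#T\ge n$, the space $V^{\mathfrak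 S_{\Psi|T}}$ is finite-dimensional over the field $K^{\mathfrak S_{\Psi|T}}$ and $$P_V(\#T)=\dim_{K^{\mathfrak S_{\Psi|T}}}V^{\mathfrak S_{\Psi|T}}.$$ In particular, $V$ is admissible, i.e. $\dim_{K^U}V^U<\infty$ for every open subgroup $U\subseteq\mathfrak S_\Psi$. -/

import Mathlib

open scoped Topology Pointwise

/-- The topology on the group of all permutations of `Ψ` whose open sets are generated by the
left translates `g • Stab(x)` of the stabilizers of the elements of `Ψ`. -/
@[reducible] def permTopology (Ψ : Type*) : TopologicalSpace (Equiv.Perm Ψ) :=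
  TopologicalSpace.generateFrom
    {S | ∃ (g : Equiv.Perm Ψ) (x : Ψ),
      S = g • (MulAction.stabilizer (Equiv.Perm Ψ) x : Set (Equiv.Perm Ψ))}

/-- The subgroup `U` is open in the group of all permutations of `Ψ`. -/
def IsOpenSubgroup {Ψ : Type*} (U : Subgroup (Equiv.Perm Ψ)) : Prop :=
  IsOpen[permTopology Ψ] (U : Set (Equiv.Perm Ψ))

/-- A set with an action of the group of permutations of `Ψ` is smooth if
the stabilizers of all its elements are open. -/
def IsSmoothAction (Ψ X : Type*) [MulAction (Equiv.Perm Ψ) X] : Prop :=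
  ∀ x : X, IsOpenSubgroup (MulAction.stabilizer (Equiv.Perm Ψ) x)

/-- The action of `G` on `X` is non-trivial: some element of `G` moves some element of `X`. -/
def IsNontrivialAction (G X : Type*) [Group G] [MulAction G X] : Prop :=
  ∃ (g : G) (x : X), g • x ≠ x

/-- The `K`-semilinear representation `V` of `G` is finitely generated: there are finitely many
vectors such that `V` is the `K`-linear span of all their `G`-translates. Equivalently, `V` is
finitely generated as a module over the skew group ring of `G` with coefficients in `K`. -/
def IsFinitelyGeneratedRep (G K V : Type*) [Group G] [Field K] [AddCommGroup V] [Module K V]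
    [MulAction G V] : Prop :=
  ∃ S : Set V, S.Finite ∧ Submodule.span K {w : V | ∃ (g : G), ∃ v ∈ S, w = g • v} = ⊤

/-- For a `K`-semilinear representation `V` of `G` and a subgroup `U` of `G`, the space `V ^ U` of
`U`-fixed vectors, as a vector space over the field `K ^ U` of `U`-fixed elements of `K`. -/
def fixedVectors {G : Type*} (K V : Type*) [Group G] [Field K] [MulSemiringAction G K]
    [AddCommGroup V] [Module K V] [DistribMulAction G V] [SMulDistribClass G K V]
    (U : Subgroup G) : Submodule (FixedPoints.subfield U K) V where
  carrier := {v | ∀ g ∈ U, g • v = v}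
  zero_mem' := fun g _ => smul_zero g
  add_mem' := fun hv hw g hg => by rw [smul_add, hv g hg, hw g hg]
  smul_mem' := fun a v hv g hg => by
    have ha : g • (a : K) = a := a.2 ⟨g, hg⟩
    change g • ((a : K) • v) = (a : K) • v
    rw [smul_distrib_smul, ha, hv g hg]

/-- The pointwise stabilizer of the finite subset `T` of `Ψ` in the group of permutations. -/
abbrev pointwiseStabilizer {Ψ : Type*} (T : Finset Ψ) : Subgroup (Equiv.Perm Ψ) :=
  fixingSubgroup (Equiv.Perm Ψ) (T : Set Ψ)

/-! Since the action on `K` is smooth and non-trivial, `K` has elements that tell apart the points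
of `Ψ` outside some finite `S` (`IsSmoothAction.exists_separating`). So for finite `A` disjoint from
`S`, the permutations of `A` act faithfully on the subfield of `K` fixed by the pointwise stabilizer
of `S ∪ A`. Galois descent (`mem_span_fixed_of_separating`) then shows that vectors fixed by this
stabilizer lie in the span of vectors fixed also under permutations of `A`. Consequently `V` is
spanned by finitely many families `e (j, A)`, with `A` running over the `deg j`-element subsets of
the complement of `S`, permuted by the pointwise stabilizer of `S` (`exists_spanning_system`).

A linear relation involving a vector of maximal degree makes, after enlarging `S`, a whole family of
that degree redundant, at the cost of new families of lower degree (`exists_fewer_of_mem_span`). The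
process terminates in a basis of `V` of the same shape (`exists_linearIndepOn`).

For `T ⊇ S`, a vector fixed by the pointwise stabilizer of `T` has finite support in this basis,
stable under that stabilizer; a set `A` not contained in `T` has an infinite orbit, so only `A ⊆ T \
S` occur. The dimension is therefore the sum over `j` of the binomial coefficients of `#T - #S` over
`deg j`, a polynomial in `#T`. -/

section Permutations

/-! ### Finite supports and the topology of the permutation group -/

variable {Ψ : Type*}

theorem mem_pointwiseStabilizer {T : Finset Ψ} {g : Equiv.Perm Ψ} :
    g ∈ pointwiseStabilizer T ↔ ∀ x ∈ T, g x = x := by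
  simp [pointwiseStabilizer, mem_fixingSubgroup_iff]

theorem pointwiseStabilizer_anti {S T : Finset Ψ} (h : S ⊆ T) :
    pointwiseStabilizer T ≤ pointwiseStabilizer S := fun _ hg =>
  mem_pointwiseStabilizer.2 fun x hx => mem_pointwiseStabilizer.1 hg x (h hx)

variable [DecidableEq Ψ]

theorem swap_mem_pointwiseStabilizer {T : Finset Ψ} {y z : Ψ} (hy : y ∉ T) (hz : z ∉ T) :
    Equiv.swap y z ∈ pointwiseStabilizer T :=
  mem_pointwiseStabilizer.2 fun x hx =>
    Equiv.swap_apply_of_ne_of_ne (by rintro rfl; exact hy hx) (by rintro rfl; exact hz hx)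

/-- An injective map on a finite set extends to a permutation. -/
theorem exists_perm_extending (f : Ψ → Ψ) (T : Finset Ψ) (hf : Set.InjOn f T) :
    ∃ g : Equiv.Perm Ψ, ∀ x ∈ T, g x = f x := by
  induction T using Finset.induction_on with
  | empty => exact ⟨1, by simp⟩
  | insert t T ht ih =>
    obtain ⟨g, hg⟩ := ih (hf.mono (by simp))
    refine ⟨Equiv.swap (g t) (f t) * g, fun x hx => ?_⟩
    rcases Finset.mem_insert.1 hx with rfl | hx'
    · simp
    · have h1 : x ≠ t := by rintro rfl; exact ht hx'
      rw [Equiv.Perm.mul_apply, Equiv.swap_apply_of_ne_of_ne, hg x hx']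
      · exact fun h => h1 (g.injective h)
      · rw [hg x hx']
        exact fun h => h1 (hf (by simp [hx']) (by simp) h)

/-- The pointwise stabilizer of `S` acts transitively on the finite sets of given cardinality
which are disjoint from `S`. -/
theorem exists_mem_pointwiseStabilizer_smul_eq {S A B : Finset Ψ} (hA : Disjoint A S)
    (hB : Disjoint B S) (h : A.card = B.card) : ∃ g ∈ pointwiseStabilizer S, g • A = B := by
  let φ := Finset.equivOfCardEq h
  let f : Ψ → Ψ := fun x => if hx : x ∈ A then φ ⟨x, hx⟩ else x
  have hfA : ∀ x (hx : x ∈ A), f x = φ ⟨x, hx⟩ := fun x hx => by simp [f, hx]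
  have hfS : ∀ x ∈ S, f x = x := fun x hx => by
    simp [f, Finset.disjoint_right.1 hA hx]
  have hfB : ∀ x ∈ A, f x ∈ B := fun x hx => by rw [hfA x hx]; exact (φ ⟨x, hx⟩).2
  obtain ⟨g, hg⟩ := exists_perm_extending f (A ∪ S) (by
    intro x hx y hy hxy
    simp only [Finset.coe_union, Set.mem_union, Finset.mem_coe] at hx hy
    rcases hx with hx | hx <;> rcases hy with hy | hy
    · rw [hfA x hx, hfA y hy] at hxy
      simpa using φ.injective (Subtype.ext hxy)
    · exact absurd (hfB x hx) (by rw [hxy, hfS y hy]; exact Finset.disjoint_right.1 hB hy)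
    · exact absurd (hfB y hy) (by rw [← hxy, hfS x hx]; exact Finset.disjoint_right.1 hB hx)
    · rwa [hfS x hx, hfS y hy] at hxy)
  refine ⟨g, mem_pointwiseStabilizer.2 fun x hx => ?_, ?_⟩
  · rw [hg x (Finset.mem_union_right _ hx), hfS x hx]
  · refine Finset.eq_of_subset_of_card_le (fun y hy => ?_) (by simp [h])
    obtain ⟨x, hx, rfl⟩ := Finset.mem_smul_finset.1 hy
    rw [Equiv.Perm.smul_def, hg x (Finset.mem_union_left _ hx)]
    exact hfB x hx

theorem smul_eq_self_of_mem_pointwiseStabilizer {S A : Finset Ψ} (h : A ⊆ S) {g : Equiv.Perm Ψ}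
    (hg : g ∈ pointwiseStabilizer S) : g • A = A := by
  refine Finset.eq_of_subset_of_card_le (fun y hy => ?_) (by simp)
  obtain ⟨x, hx, rfl⟩ := Finset.mem_smul_finset.1 hy
  rwa [Equiv.Perm.smul_def, mem_pointwiseStabilizer.1 hg x (h hx)]

theorem disjoint_smul_of_mem_pointwiseStabilizer {S A : Finset Ψ} (h : Disjoint A S)
    {g : Equiv.Perm Ψ} (hg : g ∈ pointwiseStabilizer S) : Disjoint (g • A) S := by
  rw [← smul_eq_self_of_mem_pointwiseStabilizer subset_rfl hg, Finset.disjoint_left]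
  intro x hx hx'
  rw [← Finset.inv_smul_mem_iff] at hx hx'
  exact Finset.disjoint_left.1 h hx hx'

/-- By induction on the generation of the topology, an open set containing `g` contains every
permutation agreeing with `g` on some finite set; this is applied at `g = 1`. -/
theorem exists_pointwiseStabilizer_le_of_isOpenSubgroup {U : Subgroup (Equiv.Perm Ψ)}
    (hU : IsOpenSubgroup U) : ∃ T : Finset Ψ, pointwiseStabilizer T ≤ U := by
  have key : ∀ O : Set (Equiv.Perm Ψ), IsOpen[permTopology Ψ] O → ∀ g ∈ O,
      ∃ T : Finset Ψ, ∀ h : Equiv.Perm Ψ, (∀ t ∈ T, h t = g t) → h ∈ O := by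
    intro O hO
    induction hO with
    | basic s hs =>
      obtain ⟨k, x, rfl⟩ := hs
      refine fun g hg => ⟨{x}, fun h hh => ?_⟩
      have hx : h x = g x := hh x (by simp)
      rw [Set.mem_smul_set_iff_inv_smul_mem] at hg ⊢
      simpa [MulAction.mem_stabilizer_iff, hx] using hg
    | univ => exact fun g _ => ⟨∅, by simp⟩
    | inter s t _ _ hs ht =>
      intro g hg
      obtain ⟨T, hT⟩ := hs g hg.1
      obtain ⟨T', hT'⟩ := ht g hg.2
      exact ⟨T ∪ T', fun h hh => ⟨hT h fun t m => hh t (Finset.mem_union_left _ m),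
        hT' h fun t m => hh t (Finset.mem_union_right _ m)⟩⟩
    | sUnion s _ ih =>
      rintro g ⟨t, ht, hg⟩
      obtain ⟨T, hT⟩ := ih t ht g hg
      exact ⟨T, fun h hh => ⟨t, ht, hT h hh⟩⟩
  obtain ⟨T, hT⟩ := key _ hU 1 U.one_mem
  exact ⟨T, fun g hg => hT g fun t ht => by simp [mem_pointwiseStabilizer.1 hg t ht]⟩

theorem IsSmoothAction.exists_finset {X : Type*} [MulAction (Equiv.Perm Ψ) X]
    (hX : IsSmoothAction Ψ X) (x : X) :
    ∃ T : Finset Ψ, ∀ g ∈ pointwiseStabilizer T, g • x = x := by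
  obtain ⟨T, hT⟩ := exists_pointwiseStabilizer_le_of_isOpenSubgroup (hX x)
  exact ⟨T, fun g hg => hT hg⟩

/-- A subgroup containing the pointwise stabilizers of `S ∪ {y}` and of `S ∪ {z}` for distinct
`y, z ∉ S` contains the pointwise stabilizer of `S`. -/
theorem pointwiseStabilizer_le_of_insert_le [Infinite Ψ] {S : Finset Ψ} {y z : Ψ} (hy : y ∉ S)
    (hz : z ∉ S) (hyz : y ≠ z) {U : Subgroup (Equiv.Perm Ψ)}
    (hUy : pointwiseStabilizer (insert y S) ≤ U) (hUz : pointwiseStabilizer (insert z S) ≤ U) :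
    pointwiseStabilizer S ≤ U := by
  -- The transposition of `y` and `g y` fixes `S` and `z`, and its product with `g` fixes `S` and
  -- `y`; both therefore lie in `U`.
  have step : ∀ g ∈ pointwiseStabilizer S, g y ≠ z → g ∈ U := by
    intro g hg hgz
    have hgy : g y ∉ S := fun h => hy (by
      rwa [← g.injective (mem_pointwiseStabilizer.1 hg _ h)])
    have h1 : Equiv.swap y (g y) ∈ U := hUz (swap_mem_pointwiseStabilizer
      (by simp [hyz, hy]) (by simp [hgz, hgy]))
    have h2 : Equiv.swap y (g y) * g ∈ U := by
      refine hUy (mem_pointwiseStabilizer.2 fun x hx => ?_)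
      rcases Finset.mem_insert.1 hx with rfl | hx'
      · simp
      · rw [Equiv.Perm.mul_apply, mem_pointwiseStabilizer.1 hg x hx']
        exact mem_pointwiseStabilizer.1 (swap_mem_pointwiseStabilizer hy hgy) x hx'
    exact (Subgroup.mul_mem_cancel_left _ h1).1 h2
  intro g hg
  obtain ⟨u, hu⟩ := Infinite.exists_notMem_finset (insert y (insert z S))
  simp only [Finset.mem_insert, not_or] at hu
  -- If `g y = z`, composing with the transposition of `z` and the fresh point `u`, which lies in
  -- `U`, reduces to the previous case.
  by_cases hgz : g y = z
  · have h1 : Equiv.swap z u ∈ U := hUy (swap_mem_pointwiseStabilizer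
      (by simp [hyz.symm, hz]) (by simp [hu]))
    refine (Subgroup.mul_mem_cancel_left _ h1).1 (step _ ?_ ?_)
    · exact mul_mem (swap_mem_pointwiseStabilizer hz hu.2.2) hg
    · simp [hgz, hu.2.1]
  · exact step g hg hgz

/-- For a non-trivial smooth action there is a finite set `S` such that the points outside `S`
are separated by elements supported on `S` and one more point. -/
theorem IsSmoothAction.exists_separating [Infinite Ψ] {X : Type*} [MulAction (Equiv.Perm Ψ) X]
    (hX : IsSmoothAction Ψ X) (hX' : IsNontrivialAction (Equiv.Perm Ψ) X) :
    ∃ S : Finset Ψ, ∀ y ∉ S, ∃ a : X, (∀ g ∈ pointwiseStabilizer (insert y S), g • a = a) ∧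
      ∀ g ∈ pointwiseStabilizer S, g y ≠ y → g • a ≠ a := by
  -- A non-invariant element `a` with a support `T` of least cardinality is chosen; `S` will be `T`
  -- without one point `t`, and the separating element for `y` is `a` with `t` moved to `y`.
  have hex : ∃ n, ∃ T : Finset Ψ, T.card = n ∧ ∃ a : X,
      (∀ g ∈ pointwiseStabilizer T, g • a = a) ∧ ∃ g : Equiv.Perm Ψ, g • a ≠ a := by
    obtain ⟨g, a, hga⟩ := hX'
    obtain ⟨T, hT⟩ := hX.exists_finset a
    exact ⟨_, T, rfl, a, hT, g, hga⟩
  classical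
  obtain ⟨T, hTc, a, hTa, g₀, hg₀⟩ := Nat.find_spec hex
  have hmin := fun m (hm : m < Nat.find hex) => Nat.find_min hex hm
  obtain ⟨t, ht⟩ : T.Nonempty := by
    rw [Finset.nonempty_iff_ne_empty]
    rintro rfl
    exact hg₀ (hTa g₀ (mem_pointwiseStabilizer.2 (by simp)))
  have hfix : ∀ y ∉ T.erase t, ∀ h ∈ pointwiseStabilizer (insert y (T.erase t)),
      h • Equiv.swap t y • a = Equiv.swap t y • a := by
    intro y hy h hh
    rw [← inv_smul_eq_iff, smul_smul, smul_smul]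
    refine hTa _ (mem_pointwiseStabilizer.2 fun x hx => ?_)
    have hs : Equiv.swap t y x ∈ insert y (T.erase t) := by
      by_cases hxt : x = t
      · subst hxt; simp
      · have : x ∈ T.erase t := Finset.mem_erase.2 ⟨hxt, hx⟩
        rw [Equiv.swap_apply_of_ne_of_ne hxt (by rintro rfl; exact hy this)]
        exact Finset.mem_insert_of_mem this
    simp [mem_pointwiseStabilizer.1 hh _ hs]
  refine ⟨T.erase t, fun y hy => ⟨Equiv.swap t y • a, hfix y hy, fun g hg hgy hga => ?_⟩⟩
  have hgyS : g y ∉ T.erase t := fun h => hy (by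
    rwa [← g.injective (mem_pointwiseStabilizer.1 hg _ h)])
  -- If `g` fixed the element, both `S ∪ {y}` and `S ∪ {g y}` would support it, hence so would `S`,
  -- against the minimality of `T`.
  have hle : pointwiseStabilizer (T.erase t) ≤
      MulAction.stabilizer (Equiv.Perm Ψ) (Equiv.swap t y • a) := by
    refine pointwiseStabilizer_le_of_insert_le hy hgyS hgy.symm (hfix y hy) fun h hh => ?_
    have h1 : g⁻¹ * h * g ∈ pointwiseStabilizer (insert y (T.erase t)) := by
      refine mem_pointwiseStabilizer.2 fun x hx => ?_
      have : h (g x) = g x := by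
        refine mem_pointwiseStabilizer.1 hh _ ?_
        rcases Finset.mem_insert.1 hx with rfl | hx
        · simp
        · rw [mem_pointwiseStabilizer.1 hg x hx]; exact Finset.mem_insert_of_mem hx
      simp [this]
    have h2 := hfix y hy _ h1
    rw [mul_smul, mul_smul, inv_smul_eq_iff, hga] at h2
    exact h2
  refine hmin (T.erase t).card (hTc ▸ Finset.card_erase_lt_of_mem ht)
    ⟨_, rfl, Equiv.swap t y • a, hle, Equiv.swap t y * g₀ * (Equiv.swap t y)⁻¹, ?_⟩
  rw [mul_smul, inv_smul_smul, mul_smul]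
  exact fun h => hg₀ (smul_left_cancel _ h)

end Permutations

/-! ### Fixed vectors of semilinear representations -/

section Semilinear

variable {G K V : Type*} [Group G] [Field K] [MulSemiringAction G K]
  [AddCommGroup V] [Module K V] [DistribMulAction G V] [SMulDistribClass G K V]

/-- If `g` maps a generating set of a subspace into a subspace, then it maps the first subspace
into the second one. -/
theorem smul_mem_of_mem_span {X : Set V} {W : Submodule K V} {g : G}
    (h : ∀ x ∈ X, g • x ∈ W) {v : V} (hv : v ∈ Submodule.span K X) : g • v ∈ W := by
  induction hv using Submodule.span_induction with
  | mem x hx => exact h x hx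
  | zero => rw [smul_zero]; exact W.zero_mem
  | add x y _ _ hx hy => rw [smul_add]; exact W.add_mem hx hy
  | smul a x _ hx => rw [smul_distrib_smul]; exact W.smul_mem _ hx

/-- If `g` permutes a linearly independent family, then the coordinates of a `g`-fixed vector are
permuted by `g` accordingly. -/
theorem LinearIndependent.coord_smul {ι : Type*} {f : ι → V} (hf : LinearIndependent K f) {g : G}
    {σ : ι → ι} (hσ : Function.Injective σ) (hfσ : ∀ i, g • f i = f (σ i)) {l : ι →₀ K}
    (hl : g • Finsupp.linearCombination K f l = Finsupp.linearCombination K f l) (i : ι) :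
    l (σ i) = g • l i := by
  have h : Finsupp.linearCombination K f
      (Finsupp.mapDomain σ (l.mapRange (fun a => g • a) (smul_zero g))) =
      Finsupp.linearCombination K f l := by
    rw [Finsupp.linearCombination_mapDomain, ← hl, Finsupp.linearCombination_apply,
      Finsupp.linearCombination_apply, Finsupp.sum_mapRange_index (by simp), Finsupp.smul_sum]
    simp [smul_distrib_smul, hfσ]
  have h' := DFunLike.congr_fun (hf h) (σ i)
  rwa [Finsupp.mapDomain_apply hσ, Finsupp.mapRange_apply, eq_comm] at h'

/-- A vector fixed by `U` in the span of `U`-fixed linearly independent vectors is a linear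
combination with `U`-fixed coefficients. -/
theorem mem_span_subfield_of_fixed {ι : Type*} {f : ι → V} (hf : LinearIndependent K f)
    {U : Subgroup G} (hfU : ∀ g ∈ U, ∀ i, g • f i = f i) {v : V} (hvU : ∀ g ∈ U, g • v = v)
    (hv : v ∈ Submodule.span K (Set.range f)) :
    v ∈ Submodule.span (FixedPoints.subfield U K) (Set.range f) := by
  obtain ⟨l, rfl⟩ := Finsupp.mem_span_range_iff_exists_finsupp.1 hv
  refine Submodule.sum_mem _ fun i _ => ?_
  have hli : ∀ g : U, g • l i = l i := fun g =>
    (hf.coord_smul Function.injective_id (hfU g g.2) (hvU g g.2) i).symm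
  exact Submodule.smul_mem _ (⟨l i, hli⟩ : FixedPoints.subfield U K)
    (Submodule.subset_span ⟨i, rfl⟩)

/-- Fixed vectors which are linearly independent over `K` and span the fixed vectors over `K`
span them over the fixed field. -/
theorem fixedVectors_eq_span {ι : Type*} {f : ι → V} (hf : LinearIndependent K f)
    {U : Subgroup G} (hfU : ∀ g ∈ U, ∀ i, g • f i = f i)
    (hspan : ∀ v, (∀ g ∈ U, g • v = v) → v ∈ Submodule.span K (Set.range f)) :
    fixedVectors K V U = Submodule.span (FixedPoints.subfield U K) (Set.range f) := by
  refine le_antisymm (fun v hv => mem_span_subfield_of_fixed hf hfU hv (hspan v hv))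
    (Submodule.span_le.2 ?_)
  rintro _ ⟨i, rfl⟩
  exact fun g hg => hfU g hg i

/-- If the fixed vectors of a subgroup are finite-dimensional over its fixed field, then so are
the fixed vectors of any larger subgroup. -/
theorem finite_fixedVectors_of_le {H U : Subgroup G} (hHU : H ≤ U)
    [hfin : Module.Finite (FixedPoints.subfield H K) (fixedVectors K V H)] :
    Module.Finite (FixedPoints.subfield U K) (fixedVectors K V U) := by
  -- A `K`-basis of the `K`-span of the `U`-fixed vectors, taken among these vectors, is also
  -- independent over the fixed field of `H` inside the `H`-fixed vectors, hence finite.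
  obtain ⟨b, hbU, hbspan, hb⟩ := exists_linearIndependent K {v : V | ∀ g ∈ U, g • v = v}
  have hbH : ∀ x : b, (x : V) ∈ fixedVectors K V H := fun x g hg => hbU x.2 g (hHU hg)
  have hbH' : LinearIndependent (FixedPoints.subfield H K)
      (fun x : b => (⟨x, hbH x⟩ : fixedVectors K V H)) :=
    LinearIndependent.of_comp (fixedVectors K V H).subtype (hb.restrict_scalars' _)
  have : Finite b := hbH'.finite
  rw [fixedVectors_eq_span (K := K) (V := V) (U := U) hb (fun g hg i => hbU i.2 g hg)
    (fun v hv => by rw [Subtype.range_coe, hbspan]; exact Submodule.subset_span hv)]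
  exact Module.Finite.span_of_finite _ (Set.finite_range _)

end Semilinear

/-! ### Galois descent -/

section Descent

variable {Ψ K V : Type*} [DecidableEq Ψ] [Field K] [MulSemiringAction (Equiv.Perm Ψ) K]
  [AddCommGroup V] [Module K V] [DistribMulAction (Equiv.Perm Ψ) V]
  [SMulDistribClass (Equiv.Perm Ψ) K V]

/-- Galois descent along the action of the permutations of `A` on the field of elements of `K`
fixed by the pointwise stabilizer of `S ∪ A`. -/
theorem mem_span_fixed_of_separating {S A : Finset Ψ} (hSA : Disjoint A S)
    (hS : ∀ y ∉ S, ∃ a : K, (∀ g ∈ pointwiseStabilizer (insert y S), g • a = a) ∧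
      ∀ g ∈ pointwiseStabilizer S, g y ≠ y → g • a ≠ a)
    {W : Submodule K V} (hW : ∀ g ∈ pointwiseStabilizer S, g • A = A → ∀ w ∈ W, g • w ∈ W)
    {v : V} (hvW : v ∈ W) (hv : ∀ g ∈ pointwiseStabilizer (S ∪ A), g • v = v) :
    v ∈ Submodule.span K
      {w | w ∈ W ∧ ∀ g ∈ pointwiseStabilizer S, g • A = A → g • w = w} := by
  -- A functional `φ` kills the invariant vectors but not `v`. Traces of `a • v` over the
  -- permutations of `A` are invariant, which gives a relation with coefficients `φ (ext π • v)`
  -- between the characters `a ↦ ext π • a` of `F`. These are distinct by separation, so Dedekind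
  -- independence forces `φ v = 0`.
  by_contra hcon
  obtain ⟨φ, hφv, hφ⟩ := Submodule.exists_le_ker_of_notMem hcon
  let F := FixedPoints.subfield (pointwiseStabilizer (S ∪ A)) K
  let ext : Equiv.Perm A →* Equiv.Perm Ψ := Equiv.Perm.ofSubtype (p := (· ∈ A))
  have hextS : ∀ π, ext π ∈ pointwiseStabilizer S := fun π => mem_pointwiseStabilizer.2
    fun x hx => Equiv.Perm.ofSubtype_apply_of_not_mem _ (Finset.disjoint_right.1 hSA hx)
  have hextA : ∀ π, ext π • A = A := fun π => by
    refine Finset.eq_of_subset_of_card_le (fun y hy => ?_) (by simp)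
    obtain ⟨x, hx, rfl⟩ := Finset.mem_smul_finset.1 hy
    rw [Equiv.Perm.smul_def, Equiv.Perm.ofSubtype_apply_of_mem _ hx]
    exact (π ⟨x, hx⟩).2
  have hsum : ∀ a : F, ∑ π, φ (ext π • v) * (ext π • (a : K)) = 0 := by
    intro a
    have ha : ∀ g ∈ pointwiseStabilizer (S ∪ A), g • ((a : K) • v) = (a : K) • v := by
      intro g hg
      rw [smul_distrib_smul, hv g hg]
      congr 1
      exact a.2 ⟨g, hg⟩
    have hmem : ∑ π, ext π • ((a : K) • v) ∈
        {w | w ∈ W ∧ ∀ g ∈ pointwiseStabilizer S, g • A = A → g • w = w} := by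
      refine ⟨Submodule.sum_mem _ fun π _ => hW _ (hextS π) (hextA π) _ (W.smul_mem _ hvW),
        fun g hg hgA => ?_⟩
      have hgA' : ∀ x, x ∈ A ↔ g x ∈ A := fun x => by
        conv_rhs => rw [← hgA, ← Equiv.Perm.smul_def, Finset.smul_mem_smul_finset_iff]
      let σ : Equiv.Perm A := g.subtypePerm (fun x => (hgA' x).symm)
      rw [Finset.smul_sum]
      refine Fintype.sum_equiv (Equiv.mulLeft σ) _ _ fun π => ?_
      rw [Equiv.coe_mulLeft, map_mul, ← inv_smul_eq_iff, smul_smul, smul_smul]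
      refine ha _ (mem_pointwiseStabilizer.2 fun x hx => ?_)
      rw [mul_assoc, Equiv.Perm.mul_apply, Equiv.Perm.inv_eq_iff_eq]
      rcases Finset.mem_union.1 hx with hx | hx
      · rw [Equiv.Perm.mul_apply, mem_pointwiseStabilizer.1 (hextS π) x hx,
          mem_pointwiseStabilizer.1 hg x hx,
          mem_pointwiseStabilizer.1 (mul_mem (hextS σ) (hextS π)) x hx]
      · simp only [Equiv.Perm.mul_apply]
        have h1 : ext π x = π ⟨x, hx⟩ := Equiv.Perm.ofSubtype_apply_of_mem _ hx
        have h2 : ext σ (π ⟨x, hx⟩) = σ (π ⟨x, hx⟩) := Equiv.Perm.ofSubtype_apply_coe _ _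
        rw [h1, h2]
        rfl
    have h0 : φ (∑ π, ext π • ((a : K) • v)) = 0 := hφ (Submodule.subset_span hmem)
    rw [map_sum] at h0
    rw [← h0]
    refine Finset.sum_congr rfl fun π _ => ?_
    rw [smul_distrib_smul, LinearMap.map_smul, smul_eq_mul, mul_comm]
  let χ : Equiv.Perm A → (F →* K) := fun π =>
    ((MulSemiringAction.toRingHom (Equiv.Perm Ψ) K (ext π)).comp F.subtype : F →+* K)
  have hχ : Function.Injective χ := by
    intro π π' h
    by_contra hne
    obtain ⟨y, hy⟩ : ∃ y, π y ≠ π' y := by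
      by_contra! hall
      exact hne (Equiv.ext hall)
    have hyS : (y : Ψ) ∉ S := Finset.disjoint_left.1 hSA y.2
    obtain ⟨a, haS, ha⟩ := hS y hyS
    have haF : a ∈ F := fun g => haS g (pointwiseStabilizer_anti (by
      intro x hx
      rcases Finset.mem_insert.1 hx with rfl | hx
      · exact Finset.mem_union_right _ y.2
      · exact Finset.mem_union_left _ hx) g.2)
    have h1 : ext π • a = ext π' • a := DFunLike.congr_fun h ⟨a, haF⟩
    refine ha ((ext π')⁻¹ * ext π) (mul_mem (inv_mem (hextS _)) (hextS _)) ?_ ?_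
    · rw [Equiv.Perm.mul_apply, Ne, Equiv.Perm.inv_eq_iff_eq]
      intro h2
      have h3 : ext π y = π y := Equiv.Perm.ofSubtype_apply_coe _ _
      have h4 : ext π' y = π' y := Equiv.Perm.ofSubtype_apply_coe _ _
      rw [h3, h4] at h2
      exact hy (Subtype.ext h2)
    · rw [mul_smul, h1, inv_smul_smul]
  have hind := (linearIndependent_monoidHom F K).comp χ hχ
  have h1 := Fintype.linearIndependent_iff.1 hind (fun π => φ (ext π • v)) (by
    funext a
    simpa [χ] using hsum a) 1
  rw [map_one, one_smul] at h1
  exact hφv h1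

end Descent

/-! ### Systems of vectors indexed by finite sets -/

section Systems

variable {Ψ : Type*}

/-- The indices `(j, A)` where `A` is a finite set disjoint from `S` of cardinality `deg j`. -/
def systemIndex {J : Type*} (S : Finset Ψ) (deg : J → ℕ) : Set (J × Finset Ψ) :=
  {p | Disjoint p.2 S ∧ p.2.card = deg p.1}

theorem systemIndex_sumElim {J J' : Type*} (S : Finset Ψ) (deg : J → ℕ) (deg' : J' → ℕ) :
    systemIndex S (Sum.elim deg deg') =
      Prod.map Sum.inl id '' systemIndex S deg ∪ Prod.map Sum.inr id '' systemIndex S deg' := by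
  ext ⟨j | j, A⟩ <;> simp [systemIndex, Prod.ext_iff]

theorem image_systemIndex_subtype {J : Type*} (P : J → Prop) (S : Finset Ψ) (deg : J → ℕ) :
    Prod.map (Subtype.val : {j // P j} → J) id '' systemIndex S (fun j : {j // P j} => deg j) =
      {p ∈ systemIndex S deg | P p.1} := by
  ext ⟨j, A⟩
  simp only [systemIndex, Set.mem_image, Set.mem_ofPred_eq, Prod.exists, Prod.map_apply, id,
    Prod.mk.injEq, Subtype.exists]
  constructor
  · rintro ⟨j, hj, A, h, rfl, rfl⟩
    exact ⟨h, hj⟩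
  · rintro ⟨h, hj⟩
    exact ⟨j, hj, A, h, rfl, rfl⟩

/-- The indices `(j, B)` of the decomposition of a system of vectors indexed by finite sets
disjoint from `S` into systems indexed by finite sets disjoint from a larger set `S'`. -/
abbrev RestrictedIndex [DecidableEq Ψ] {J : Type*} (S S' : Finset Ψ) (deg : J → ℕ) :=
  {p : J × Finset Ψ // p.2 ⊆ S' \ S ∧ p.2.card ≤ deg p.1}

/-- The remaining degree of an index of the decomposition. -/
def RestrictedIndex.degree [DecidableEq Ψ] {J : Type*} {S S' : Finset Ψ} {deg : J → ℕ}
    (q : RestrictedIndex S S' deg) : ℕ :=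
  deg q.1.1 - q.1.2.card

/-- The original index of a pair of an index of the decomposition and a finite set. -/
def RestrictedIndex.merge [DecidableEq Ψ] {J : Type*} {S S' : Finset Ψ} {deg : J → ℕ}
    (p : RestrictedIndex S S' deg × Finset Ψ) : J × Finset Ψ :=
  (p.1.1.1, p.2 ∪ p.1.1.2)

variable [DecidableEq Ψ] {J : Type*} {S S' : Finset Ψ} {deg : J → ℕ}

instance [Finite J] : Finite (RestrictedIndex S S' deg) := by
  refine Set.Finite.subset (Set.finite_univ.prod (S' \ S).powerset.finite_toSet) ?_
  rintro ⟨j, B⟩ h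
  exact ⟨trivial, Finset.mem_coe.2 (Finset.mem_powerset.2 h.1)⟩

/-- The inverse cuts a set `A` into `A ∩ S'`, recorded in the index, and `A \ S'`. -/
theorem RestrictedIndex.bijOn_merge (h : S ⊆ S') :
    Set.BijOn RestrictedIndex.merge
      (systemIndex S' (RestrictedIndex.degree (S := S) (S' := S') (deg := deg)))
      (systemIndex S deg) := by
  refine ⟨?_, ?_, ?_⟩
  · rintro ⟨⟨⟨j, B⟩, hB, hc⟩, A⟩ ⟨hA, hd⟩
    simp only [degree] at hA hd hB hc
    refine ⟨Finset.disjoint_union_left.2 ⟨hA.mono_right h, ?_⟩, ?_⟩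
    · exact Finset.disjoint_of_subset_left hB Finset.sdiff_disjoint
    · rw [merge, Finset.card_union_of_disjoint
        (hA.mono_right (hB.trans Finset.sdiff_subset)), hd]
      dsimp only
      omega
  · rintro ⟨⟨⟨j, B⟩, hB, hc⟩, A⟩ ⟨hA, hd⟩ ⟨⟨⟨j', B'⟩, hB', hc'⟩, A'⟩ ⟨hA', hd'⟩ heq
    simp only [merge, Prod.mk.injEq] at heq hA hA' hB hB'
    obtain ⟨rfl, heq⟩ := heq
    have h1 : ∀ {A B : Finset Ψ}, Disjoint A S' → B ⊆ S' \ S → (A ∪ B) ∩ S' = B ∧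
        (A ∪ B) \ S' = A := by
      intro A B hA hB
      have hB' : B ⊆ S' := hB.trans Finset.sdiff_subset
      constructor
      · rw [Finset.union_inter_distrib_right, Finset.disjoint_iff_inter_eq_empty.1 hA,
          Finset.empty_union, Finset.inter_eq_left.2 hB']
      · rw [Finset.union_sdiff_distrib, Finset.sdiff_eq_self_of_disjoint hA,
          Finset.sdiff_eq_empty_iff_subset.2 hB', Finset.union_empty]
    have hB2 : B = B' := by rw [← (h1 hA hB).1, heq, (h1 hA' hB').1]
    have hA2 : A = A' := by rw [← (h1 hA hB).2, heq, (h1 hA' hB').2]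
    subst hB2 hA2
    rfl
  · rintro ⟨j, A⟩ ⟨hA, hd⟩
    have hsub : A ∩ S' ⊆ S' \ S := fun x hx =>
      Finset.mem_sdiff.2 ⟨(Finset.mem_inter.1 hx).2,
        Finset.disjoint_left.1 hA (Finset.mem_inter.1 hx).1⟩
    refine ⟨⟨⟨(j, A ∩ S'), hsub, ?_⟩, A \ S'⟩, ⟨Finset.sdiff_disjoint, ?_⟩, ?_⟩
    · rw [← hd]; exact Finset.card_le_card Finset.inter_subset_left
    · have := Finset.card_sdiff_add_card_inter A S'
      simp only [degree]
      dsimp only at hd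
      omega
    · simp [merge, Finset.sdiff_union_inter]

variable {V : Type*} [AddCommGroup V] [DistribMulAction (Equiv.Perm Ψ) V]

/-- A system of vectors indexed by finite sets which is equivariant under the pointwise
stabilizer of `S`. -/
def IsEquivariantSystem (S : Finset Ψ) (e : J × Finset Ψ → V) : Prop :=
  ∀ g ∈ pointwiseStabilizer S, ∀ j A, g • e (j, A) = e (j, g • A)

end Systems

/-- A nonzero common vector gives a relation in which some `e p` with `p ∈ t` has a nonzero
coefficient; solving for `e p` puts it in the span of the others. -/
theorem disjoint_span_of_notMem_span {ι K V : Type*} [Field K] [AddCommGroup V] [Module K V]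
    {e : ι → V} {s t : Set ι} (hst : Disjoint s t)
    (h : ∀ p ∈ t, e p ∉ Submodule.span K (e '' ((s ∪ t) \ {p}))) :
    Disjoint (Submodule.span K (e '' s)) (Submodule.span K (e '' t)) := by
  classical
  rw [Submodule.disjoint_def]
  intro x hxs hxt
  obtain ⟨l, hl, rfl⟩ := (Finsupp.mem_span_image_iff_linearCombination K).1 hxt
  by_contra hne
  obtain ⟨p, hp⟩ : ∃ p, l p ≠ 0 := by
    by_contra! hall
    exact hne (by rw [show l = 0 from Finsupp.ext hall, map_zero])
  have hpt : p ∈ t := hl (Finsupp.mem_support_iff.2 hp)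
  refine h p hpt ?_
  rw [← Submodule.smul_mem_iff _ hp]
  have h1 : l p • e p = Finsupp.linearCombination K e l -
      Finsupp.linearCombination K e (l.erase p) := by
    conv_rhs => rw [← Finsupp.single_add_erase p l]
    simp
  rw [h1]
  refine Submodule.sub_mem _ (Submodule.span_mono (Set.image_mono ?_) hxs)
    ((Finsupp.mem_span_image_iff_linearCombination K).2 ⟨_, ?_, rfl⟩)
  · exact fun q hq => ⟨Or.inl hq, by rintro rfl; exact Set.disjoint_left.1 hst hq hpt⟩
  · intro q hq
    rw [Finsupp.support_erase, Finset.coe_erase] at hq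
    exact ⟨Or.inr (hl hq.1), hq.2⟩

/-! ### Reduction of a spanning system to a basis -/

section Reduction

universe u v w x

variable {Ψ : Type u} [DecidableEq Ψ] {V : Type v} [AddCommGroup V]
  [DistribMulAction (Equiv.Perm Ψ) V]

namespace IsEquivariantSystem

section

variable {J J' : Type*} {S S' : Finset Ψ} {deg : J → ℕ} {deg' : J' → ℕ}
  {e : J × Finset Ψ → V} {e' : J' × Finset Ψ → V}

theorem merge (he : IsEquivariantSystem S e) (h : S ⊆ S') :
    IsEquivariantSystem S'
      (e ∘ RestrictedIndex.merge (S := S) (S' := S') (deg := deg)) := by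
  rintro g hg ⟨⟨j, B⟩, hB, hc⟩ A
  simp only [Function.comp_apply, RestrictedIndex.merge]
  rw [he g (pointwiseStabilizer_anti h hg), Finset.smul_finset_union,
    smul_eq_self_of_mem_pointwiseStabilizer (hB.trans Finset.sdiff_subset) hg]

theorem comp_map (he : IsEquivariantSystem S e) (f : J' → J) :
    IsEquivariantSystem S (e ∘ Prod.map f id) := fun g hg j A => he g hg (f j) A

/-- The union of two systems. -/
theorem sumElim (he : IsEquivariantSystem S e) (he' : IsEquivariantSystem S e') :
    IsEquivariantSystem S
      (fun p : (J ⊕ J') × Finset Ψ => Sum.elim (fun j => e (j, p.2)) (fun j => e' (j, p.2)) p.1) := by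
  rintro g hg (j | j) A
  · exact he g hg j A
  · exact he' g hg j A

variable {K : Type x} [Field K] [MulSemiringAction (Equiv.Perm Ψ) K] [Module K V]
  [SMulDistribClass (Equiv.Perm Ψ) K V]

theorem smul_mem_span (he : IsEquivariantSystem S e) {g : Equiv.Perm Ψ}
    (hg : g ∈ pointwiseStabilizer S) {v : V}
    (hv : v ∈ Submodule.span K (e '' systemIndex S deg)) :
    g • v ∈ Submodule.span K (e '' systemIndex S deg) := by
  refine smul_mem_of_mem_span ?_ hv
  rintro _ ⟨⟨j, A⟩, ⟨hA, hc⟩, rfl⟩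
  rw [he g hg]
  exact Submodule.subset_span ⟨_, ⟨disjoint_smul_of_mem_pointwiseStabilizer hA hg,
    by simpa using hc⟩, rfl⟩

end

variable {K : Type x} [Field K] [MulSemiringAction (Equiv.Perm Ψ) K] [Module K V]
  [SMulDistribClass (Equiv.Perm Ψ) K V]

/-- If a vector of maximal degree is a linear combination of other vectors of the system, then
after enlarging `S` the number of orbits of maximal degree can be decreased. -/
theorem exists_fewer_of_mem_span {J : Type (max u w)} [Finite J] {S : Finset Ψ} {deg : J → ℕ}
    {e : J × Finset Ψ → V} (he : IsEquivariantSystem S e) {N : ℕ} (hdeg : ∀ j, deg j ≤ N)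
    {j₀ : J} {A₀ : Finset Ψ} (hp : (j₀, A₀) ∈ systemIndex S deg) (hj₀ : deg j₀ = N)
    (hmem : e (j₀, A₀) ∈ Submodule.span K (e '' (systemIndex S deg \ {(j₀, A₀)}))) :
    ∃ S', S ⊆ S' ∧ ∃ (J' : Type (max u w)) (_ : Finite J') (deg' : J' → ℕ)
      (e' : J' × Finset Ψ → V), IsEquivariantSystem S' e' ∧ (∀ j, deg' j ≤ N) ∧
      {j | deg' j = N}.ncard < {j | deg j = N}.ncard ∧
      Submodule.span K (e' '' systemIndex S' deg') =
        Submodule.span K (e '' systemIndex S deg) := by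
  classical
  obtain ⟨F, hF, hFmem⟩ : ∃ F : Finset (J × Finset Ψ), (F : Set _) ⊆
      systemIndex S deg \ {(j₀, A₀)} ∧ e (j₀, A₀) ∈ Submodule.span K (e '' F) := by
    obtain ⟨l, hl, hl'⟩ := (Finsupp.mem_span_image_iff_linearCombination K).1 hmem
    exact ⟨l.support, hl, (Finsupp.mem_span_image_iff_linearCombination K).2
      ⟨l, fun _ h => h, hl'⟩⟩
  -- All sets of the relation are absorbed except for the points of `A₀`. A set of the relation in
  -- family `j₀` disjoint from `S'` would lie in `A₀` and have the same cardinality, hence be `A₀`,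
  -- which is excluded. So the relation avoids the new family `(j₀, ∅)`, which can be dropped.
  let S' := (S ∪ F.biUnion Prod.snd) \ A₀
  have hSS' : S ⊆ S' := fun x hx => Finset.mem_sdiff.2
    ⟨Finset.mem_union_left _ hx, Finset.disjoint_right.1 hp.1 hx⟩
  let J' := {q : RestrictedIndex S S' deg // q.1 ≠ (j₀, ∅)}
  let deg' : J' → ℕ := fun q => q.1.degree
  let e' : J' × Finset Ψ → V := (e ∘ RestrictedIndex.merge) ∘ Prod.map Subtype.val id
  have he' : IsEquivariantSystem S' e' := (he.merge hSS').comp_map _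
  have hbij := RestrictedIndex.bijOn_merge (deg := deg) hSS'
  have himage : e' '' systemIndex S' deg' = (e ∘ RestrictedIndex.merge) ''
      {p ∈ systemIndex S' (RestrictedIndex.degree (S := S) (S' := S') (deg := deg)) |
        p.1.1 ≠ (j₀, ∅)} := by
    rw [Set.image_comp _ (Prod.map _ _), image_systemIndex_subtype]
  have hA₀S' : Disjoint A₀ S' := Finset.disjoint_sdiff
  have hindex : ∀ p ∈ systemIndex S deg, (p.1 = j₀ → ¬ Disjoint p.2 S') →
      e p ∈ Submodule.span K (e' '' systemIndex S' deg') := by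
    intro p hpS hp'
    obtain ⟨q, hq, rfl⟩ := hbij.surjOn hpS
    rw [himage]
    refine Submodule.subset_span ⟨q, ⟨hq, fun hq0 => ?_⟩, rfl⟩
    refine hp' (by rw [RestrictedIndex.merge, hq0]) ?_
    rw [RestrictedIndex.merge, hq0]
    simpa using hq.1
  have hF' : ∀ p ∈ F, e p ∈ Submodule.span K (e' '' systemIndex S' deg') := by
    intro p hpF
    have hpS := hF hpF
    refine hindex p hpS.1 fun hpj hdisj => hpS.2 ?_
    have hsub : p.2 ⊆ A₀ := fun x hx => by
      by_contra hxA
      exact Finset.disjoint_left.1 hdisj hx (Finset.mem_sdiff.2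
        ⟨Finset.mem_union_right _ (Finset.mem_biUnion.2 ⟨p, hpF, hx⟩), hxA⟩)
    refine Prod.ext hpj (Finset.eq_of_subset_of_card_le hsub ?_)
    have h1 := hp.2
    have h2 := hpS.1.2
    rw [hpj] at h2
    exact (h1.trans h2.symm).le
  have h0 : e (j₀, A₀) ∈ Submodule.span K (e' '' systemIndex S' deg') := by
    refine Submodule.span_le.2 ?_ hFmem
    rintro _ ⟨p, hpF, rfl⟩
    exact hF' p hpF
  refine ⟨S', hSS', J', inferInstance, deg', e', he', fun q => ?_, ?_,
    le_antisymm (Submodule.span_mono ?_) (Submodule.span_le.2 ?_)⟩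
  · exact (Nat.sub_le _ _).trans (hdeg _)
  -- Only `B = ∅` leaves the degree maximal, so the new families of degree `N` inject into the old
  -- ones other than `j₀`. The bound `#B ≤ deg j` keeps the natural subtraction exact.
  · have hempty : ∀ q : J', deg' q = N → q.1.1.2 = ∅ := by
      intro q hq
      have h1 := hdeg q.1.1.1
      have h2 := q.1.2.2
      rw [← Finset.card_eq_zero]
      simp only [deg', RestrictedIndex.degree] at hq
      omega
    refine lt_of_le_of_lt (Set.ncard_le_ncard_of_injOn (t := {j | deg j = N} \ {j₀})
      (fun q : J' => q.1.1.1) ?_ ?_) (Set.ncard_sdiff_singleton_lt_of_mem hj₀)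
    · intro q hq
      have h1 := hempty q hq
      refine ⟨?_, fun h2 => q.2 (Prod.ext h2 h1)⟩
      simpa [deg', RestrictedIndex.degree, h1] using hq
    · intro q hq q' hq' h
      exact Subtype.ext (Subtype.ext (Prod.ext h ((hempty q hq).trans (hempty q' hq').symm)))
  · rw [himage, ← hbij.image_eq, ← Set.image_comp]
    exact Set.image_mono fun _ h => h.1
  · rintro _ ⟨⟨j, A⟩, hpS, rfl⟩
    -- The dropped vectors are all translates of `e (j₀, A₀)` under the pointwise stabilizer of
    -- `S'`, which preserves the new span.
    by_cases hp' : j = j₀ ∧ Disjoint A S'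
    · obtain ⟨rfl, hA⟩ := hp'
      obtain ⟨g, hg, rfl⟩ := exists_mem_pointwiseStabilizer_smul_eq hA₀S' hA
        (hp.2.trans hpS.2.symm)
      rw [← he g (pointwiseStabilizer_anti hSS' hg)]
      exact he'.smul_mem_span hg h0
    · exact hindex _ hpS fun h1 h2 => hp' ⟨h1, h2⟩

/-- After enlarging `S`, any equivariant system can be replaced by a linearly independent one
with the same span. -/
theorem exists_linearIndepOn {J : Type (max u w)} [Finite J] {S : Finset Ψ} {deg : J → ℕ}
    {e : J × Finset Ψ → V} (he : IsEquivariantSystem S e) {N : ℕ} (hdeg : ∀ j, deg j < N) :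
    ∃ S', S ⊆ S' ∧ ∃ (J' : Type (max u w)) (_ : Finite J') (deg' : J' → ℕ)
      (e' : J' × Finset Ψ → V), IsEquivariantSystem S' e' ∧
      LinearIndepOn K e' (systemIndex S' deg') ∧
      Submodule.span K (e' '' systemIndex S' deg') =
        Submodule.span K (e '' systemIndex S deg) := by
  induction N generalizing J S with
  | zero =>
    have : IsEmpty J := ⟨fun j => by simpa using hdeg j⟩
    refine ⟨S, subset_rfl, J, inferInstance, deg, e, he, ?_, rfl⟩
    rw [Set.eq_empty_of_isEmpty (systemIndex S deg)]
    exact linearIndepOn_empty K e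
  | succ N ihN =>
    -- The inner induction is on the number of families of top degree, the outer one on the degree
    -- bound.
    induction hκ : {j | deg j = N}.ncard using Nat.strong_induction_on generalizing J S with
    | h κ ihκ =>
    by_cases hred : ∃ p ∈ systemIndex S deg, deg p.1 = N ∧
        e p ∈ Submodule.span K (e '' (systemIndex S deg \ {p}))
    · obtain ⟨⟨j₀, A₀⟩, hp, hpN, hmem⟩ := hred
      obtain ⟨S₁, hS₁, J₁, hJ₁, deg₁, e₁, he₁, hdeg₁, hlt, hspan₁⟩ :=
        exists_fewer_of_mem_span.{u, v, w} he (fun j => Nat.lt_succ_iff.1 (hdeg j)) hp hpN hmem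
      obtain ⟨S₂, hS₂, J₂, hJ₂, deg₂, e₂, he₂, hli, hspan₂⟩ :=
        ihκ _ (hκ ▸ hlt) he₁ (fun j => Nat.lt_succ_iff.2 (hdeg₁ j)) rfl
      exact ⟨S₂, hS₁.trans hS₂, J₂, hJ₂, deg₂, e₂, he₂, hli, hspan₂.trans hspan₁⟩
    -- Without a relation in top degree, the top vectors are independent and their span meets that
    -- of the rest in zero. The lower part is handled by the outer induction; the top part is merely
    -- reindexed over the enlarged `S'`.
    · push Not at hred
      obtain ⟨S', hSS', J₁, hJ₁, deg₁, e₁, he₁, hli₁, hspan₁⟩ :=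
        ihN (J := {j // deg j < N}) (he.comp_map Subtype.val) (fun j => j.2)
      rw [Set.image_comp, image_systemIndex_subtype (fun j => deg j < N)] at hspan₁
      let degN : {j // deg j = N} → ℕ := fun j => deg j
      let e₂ := (e ∘ Prod.map (Subtype.val : {j // deg j = N} → J) id) ∘
        RestrictedIndex.merge (S := S) (S' := S') (deg := degN)
      have hbij := RestrictedIndex.bijOn_merge (deg := degN) hSS'
      have he₂ : IsEquivariantSystem S' e₂ := (he.comp_map Subtype.val).merge hSS'
      have himg₂ : e₂ '' systemIndex S' RestrictedIndex.degree =
          e '' {p ∈ systemIndex S deg | deg p.1 = N} := by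
        rw [Set.image_comp, hbij.image_eq, Set.image_comp,
          image_systemIndex_subtype (fun j => deg j = N)]
      have hli₂ : LinearIndepOn K e₂ (systemIndex S' RestrictedIndex.degree) := by
        refine LinearIndepOn.comp_of_image ?_ hbij.injOn
        rw [hbij.image_eq]
        refine LinearIndepOn.comp_of_image ?_
          (Function.Injective.prodMap Subtype.val_injective Function.injective_id).injOn
        rw [image_systemIndex_subtype (fun j => deg j = N), linearIndepOn_iff_notMem_span]
        exact fun p hp h => hred p hp.1 hp.2
          (Submodule.span_mono (Set.image_mono (Set.sdiff_subset_sdiff_left (Set.sep_subset _ _))) h)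
      have hdisj : Disjoint (Submodule.span K (e₁ '' systemIndex S' deg₁))
          (Submodule.span K (e₂ '' systemIndex S' RestrictedIndex.degree)) := by
        rw [hspan₁, himg₂]
        refine disjoint_span_of_notMem_span ?_ fun p hp h => hred p hp.1 hp.2
          (Submodule.span_mono (Set.image_mono ?_) h)
        · exact Set.disjoint_left.2 fun p h1 h2 => h1.2.ne h2.2
        · rintro q ⟨hq | hq, hne⟩
          · exact ⟨hq.1, hne⟩
          · exact ⟨hq.1, hne⟩
      refine ⟨S', hSS', J₁ ⊕ RestrictedIndex S S' degN, inferInstance,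
        Sum.elim deg₁ RestrictedIndex.degree, _, he₁.sumElim he₂, ?_, ?_⟩
      · rw [systemIndex_sumElim]
        refine LinearIndepOn.union (LinearIndepOn.image_of_comp _ _ hli₁)
          (LinearIndepOn.image_of_comp _ _ hli₂) ?_
        rw [← Set.image_comp, ← Set.image_comp]
        exact hdisj
      · rw [systemIndex_sumElim, Set.image_union, Submodule.span_union, ← Set.image_comp,
          ← Set.image_comp]
        change Submodule.span K (e₁ '' systemIndex S' deg₁) ⊔
          Submodule.span K (e₂ '' systemIndex S' RestrictedIndex.degree) = _
        rw [hspan₁, himg₂, ← Submodule.span_union, ← Set.image_union]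
        congr 2
        ext p
        constructor
        · rintro (h | h) <;> exact h.1
        · intro h
          rcases Nat.lt_succ_iff_lt_or_eq.1 (hdeg p.1) with h' | h'
          · exact Or.inl ⟨h, h'⟩
          · exact Or.inr ⟨h, h'⟩

end IsEquivariantSystem

end Reduction

/-! ### Spanning systems of finitely generated representations -/

section Generation

universe u v x

variable {Ψ : Type u} {V : Type v} [AddCommGroup V] [DistribMulAction (Equiv.Perm Ψ) V]

/-- The translate `g • v` depends only on `v` and on the restriction of `g` to `T`, a map from `T`
to `B`. -/
theorem finite_translates {X : Set V} (hX : X.Finite) {T : Finset Ψ}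
    (hT : ∀ v ∈ X, ∀ g ∈ pointwiseStabilizer T, g • v = v) (B : Finset Ψ) :
    {w : V | ∃ g : Equiv.Perm Ψ, (∀ t ∈ T, g t ∈ B) ∧ ∃ v ∈ X, w = g • v}.Finite := by
  classical
  have := hX.to_subtype
  let f : X × (T → B) → V := fun p =>
    if h : ∃ g : Equiv.Perm Ψ, ∀ t : T, g t = p.2 t then h.choose • (p.1 : V) else 0
  refine (Set.finite_range f).subset ?_
  rintro _ ⟨g, hg, v, hv, rfl⟩
  let φ : T → B := fun t => ⟨g t, hg t t.2⟩
  have h : ∃ k : Equiv.Perm Ψ, ∀ t : T, k t = φ t := ⟨g, fun _ => rfl⟩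
  refine ⟨(⟨v, hv⟩, φ), ?_⟩
  have h1 : f (⟨v, hv⟩, φ) = h.choose • v := dif_pos h
  rw [h1, ← inv_smul_eq_iff, smul_smul]
  refine hT v hv _ (mem_pointwiseStabilizer.2 fun t ht => ?_)
  rw [Equiv.Perm.mul_apply, Equiv.Perm.inv_eq_iff_eq, h.choose_spec ⟨t, ht⟩]

variable [DecidableEq Ψ]

/-- Vectors `w j` fixed by the setwise stabilizers of `A j` extend to an equivariant system. -/
theorem exists_isEquivariantSystem {J : Type*} {S : Finset Ψ} (A : J → Finset Ψ) (w : J → V)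
    (hw : ∀ j, ∀ g ∈ pointwiseStabilizer S, g • A j = A j → g • w j = w j) :
    ∃ e : J × Finset Ψ → V, IsEquivariantSystem S e ∧ ∀ j, e (j, A j) = w j := by
  classical
  -- The value is independent of the chosen permutation by `hw`; off the orbit of `A j` it is zero,
  -- which is equivariant too.
  let e : J × Finset Ψ → V := fun p =>
    if h : ∃ g ∈ pointwiseStabilizer S, g • A p.1 = p.2 then h.choose • w p.1 else 0
  have he : ∀ j, ∀ g ∈ pointwiseStabilizer S, e (j, g • A j) = g • w j := by
    intro j g hg
    have h : ∃ k ∈ pointwiseStabilizer S, k • A j = g • A j := ⟨g, hg, rfl⟩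
    have h1 : e (j, g • A j) = h.choose • w j := dif_pos h
    rw [h1, ← inv_smul_eq_iff, smul_smul]
    refine hw j _ (mul_mem (inv_mem hg) h.choose_spec.1) ?_
    rw [mul_smul, h.choose_spec.2, inv_smul_smul]
  refine ⟨e, fun g hg j B => ?_, fun j => by simpa using he j 1 (one_mem _)⟩
  by_cases h : ∃ k ∈ pointwiseStabilizer S, k • A j = B
  · obtain ⟨k, hk, rfl⟩ := h
    rw [he j k hk, smul_smul, smul_smul, he j _ (mul_mem hg hk)]
  · have h1 : e (j, B) = 0 := dif_neg h
    have h2 : e (j, g • B) = 0 := dif_neg fun ⟨k, hk, hkB⟩ =>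
      h ⟨g⁻¹ * k, mul_mem (inv_mem hg) hk, by
        dsimp only at hkB
        rw [mul_smul, hkB, inv_smul_smul]⟩
    rw [h1, h2, smul_zero]

variable {K : Type x} [Field K] [MulSemiringAction (Equiv.Perm Ψ) K] [Module K V]
  [SMulDistribClass (Equiv.Perm Ψ) K V]

/-- A finitely generated smooth representation is spanned by an equivariant system. -/
theorem exists_spanning_system [Infinite Ψ] (hK : IsSmoothAction Ψ K)
    (hK' : IsNontrivialAction (Equiv.Perm Ψ) K) (hV : IsSmoothAction Ψ V)
    (hV' : IsFinitelyGeneratedRep (Equiv.Perm Ψ) K V) :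
    ∃ (S : Finset Ψ) (J : Type (max u v)) (_ : Finite J) (deg : J → ℕ) (e : J × Finset Ψ → V),
      IsEquivariantSystem S e ∧ Submodule.span K (e '' systemIndex S deg) = ⊤ := by
  obtain ⟨X, hX, hspan⟩ := hV'
  obtain ⟨T, hT⟩ : ∃ T : Finset Ψ, ∀ v ∈ X, ∀ g ∈ pointwiseStabilizer T, g • v = v := by
    choose f hf using fun v : V => hV.exists_finset v
    refine ⟨hX.toFinset.biUnion f, fun v hv g hg => hf v g (pointwiseStabilizer_anti ?_ hg)⟩
    exact Finset.subset_biUnion_of_mem f (hX.mem_toFinset.2 hv)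
  obtain ⟨S, hS⟩ := hK.exists_separating hK'
  have hA : ∀ n : ℕ, ∃ A : Finset Ψ, Disjoint A S ∧ A.card = n := by
    intro n
    obtain ⟨A, hAS, hA⟩ := (S.finite_toSet.infinite_compl).exists_subset_card_eq n
    exact ⟨A, Finset.disjoint_left.2 fun x hx hxS => hAS hx hxS, hA⟩
  choose A hAS hAc using hA
  let gens : ℕ → Set V := fun n =>
    {w : V | ∃ g : Equiv.Perm Ψ, (∀ t ∈ T, g t ∈ S ∪ A n) ∧ ∃ v ∈ X, w = g • v}
  have hgens : ∀ n, (gens n).Finite := fun n => finite_translates hX hT _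
  let W : ℕ → Submodule K V := fun n => Submodule.span K (gens n)
  have hWstable : ∀ n, ∀ g ∈ pointwiseStabilizer S, g • A n = A n → ∀ w ∈ W n, g • w ∈ W n := by
    intro n g hg hgA w hw
    refine smul_mem_of_mem_span ?_ hw
    rintro _ ⟨k, hk, v, hv, rfl⟩
    refine Submodule.subset_span ⟨g * k, fun t ht => ?_, v, hv, by rw [mul_smul]⟩
    rw [Equiv.Perm.mul_apply]
    rcases Finset.mem_union.1 (hk t ht) with h | h
    · rw [mem_pointwiseStabilizer.1 hg _ h]
      exact Finset.mem_union_left _ h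
    · refine Finset.mem_union_right _ ?_
      rw [← hgA]
      exact Finset.smul_mem_smul_finset h
  let Y : ℕ → Set V := fun n =>
    {w | w ∈ W n ∧ ∀ g ∈ pointwiseStabilizer S, g • A n = A n → g • w = w}
  have hWY : ∀ n, Submodule.span K (Y n) = W n := by
    intro n
    refine le_antisymm (Submodule.span_le.2 fun w hw => hw.1) (Submodule.span_le.2 ?_)
    rintro w ⟨k, hk, v, hv, rfl⟩
    refine mem_span_fixed_of_separating (hAS n) hS (hWstable n)
      (Submodule.subset_span ⟨k, hk, v, hv, rfl⟩) fun g hg => ?_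
    rw [← inv_smul_eq_iff, smul_smul, smul_smul]
    refine hT v hv _ (mem_pointwiseStabilizer.2 fun t ht => ?_)
    rw [mul_assoc, Equiv.Perm.mul_apply, Equiv.Perm.inv_eq_iff_eq, Equiv.Perm.mul_apply,
      mem_pointwiseStabilizer.1 hg _ (hk t ht)]
  have hY : ∀ n, ∃ Y' : Finset V, (Y' : Set V) ⊆ Y n ∧ W n = Submodule.span K (Y' : Set V) := by
    intro n
    have := (Submodule.fg_span_iff_fg_span_finset_subset (R := K) (Y n)).1
      (by rw [hWY]; exact Submodule.fg_span (hgens n))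
    rwa [hWY] at this
  choose Y' hY' hWY' using hY
  -- Degrees up to `#T` suffice, since a translate of `T` has at most `#T` points outside `S`.
  let J := ULift.{max u v} (Σ n : Fin (T.card + 1), Y' n)
  obtain ⟨e, he, heA⟩ := exists_isEquivariantSystem (J := J) (S := S) (fun j => A j.down.1)
    (fun j => (j.down.2 : V)) fun j => (hY' _ j.down.2.2).2
  refine ⟨S, J, inferInstance, fun j => j.down.1, e, he, ?_⟩
  have hW : ∀ n ≤ T.card, W n ≤
      Submodule.span K (e '' systemIndex S fun j : J => (j.down.1 : ℕ)) := by
    intro n hn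
    rw [hWY', Submodule.span_le]
    intro w hw
    let j : J := ⟨⟨⟨n, Nat.lt_succ_of_le hn⟩, ⟨w, hw⟩⟩⟩
    exact Submodule.subset_span ⟨(j, A n), ⟨hAS n, hAc n⟩, heA j⟩
  rw [eq_top_iff, ← hspan, Submodule.span_le]
  rintro _ ⟨g, v, hv, rfl⟩
  -- Moving `B` onto the reference set of its cardinality by the pointwise stabilizer of `S` brings
  -- `g • v` into the corresponding `W`.
  let B := g • T \ S
  have hB : B.card ≤ T.card := (Finset.card_le_card Finset.sdiff_subset).trans (by simp)
  obtain ⟨h, hh, hhB⟩ := exists_mem_pointwiseStabilizer_smul_eq (S := S) (A := B)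
    (B := A B.card) Finset.sdiff_disjoint (hAS _) (hAc _).symm
  have h1 : (h * g) • v ∈ W B.card := by
    refine Submodule.subset_span ⟨h * g, fun t ht => ?_, v, hv, rfl⟩
    rw [Equiv.Perm.mul_apply]
    by_cases hgt : g t ∈ S
    · rw [mem_pointwiseStabilizer.1 hh _ hgt]
      exact Finset.mem_union_left _ hgt
    · refine Finset.mem_union_right _ ?_
      rw [← hhB]
      exact Finset.smul_mem_smul_finset (Finset.mem_sdiff.2
        ⟨Finset.smul_mem_smul_finset ht, hgt⟩)
  have h2 := he.smul_mem_span (inv_mem hh) (hW _ hB h1)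
  rwa [smul_smul, inv_mul_cancel_left] at h2

end Generation

/-! ### Dimension of the spaces of fixed vectors -/

section Dimension

variable {Ψ J K V : Type*} [DecidableEq Ψ] [Field K] [MulSemiringAction (Equiv.Perm Ψ) K]
  [AddCommGroup V] [Module K V] [DistribMulAction (Equiv.Perm Ψ) V]
  [SMulDistribClass (Equiv.Perm Ψ) K V] {S : Finset Ψ} {deg : J → ℕ} {e : J × Finset Ψ → V}

namespace IsEquivariantSystem

/-- Transport of a system by a permutation. -/
theorem transport (he : IsEquivariantSystem S e) (h : Equiv.Perm Ψ) :
    IsEquivariantSystem (h • S) (fun p : J × Finset Ψ => h • e (p.1, h⁻¹ • p.2)) := by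
  intro g hg j A
  have hg' : h⁻¹ * g * h ∈ pointwiseStabilizer S := mem_pointwiseStabilizer.2 fun x hx => by
    rw [mul_assoc, Equiv.Perm.mul_apply, Equiv.Perm.inv_eq_iff_eq]
    exact mem_pointwiseStabilizer.1 hg _ (Finset.smul_mem_smul_finset hx)
  have h1 := he _ hg' j (h⁻¹ • A)
  simp only [smul_smul, mul_assoc, mul_inv_cancel, mul_one] at h1
  simp only [smul_smul]
  rw [← h1, smul_smul]
  simp

theorem bijOn_transport (h : Equiv.Perm Ψ) :
    Set.BijOn (fun p : J × Finset Ψ => (p.1, h⁻¹ • p.2)) (systemIndex (h • S) deg)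
      (systemIndex S deg) := by
  have hdisj : ∀ A : Finset Ψ, Disjoint A (h • S) ↔ Disjoint (h⁻¹ • A) S := fun A => by
    simp only [Finset.disjoint_left, Finset.mem_inv_smul_finset_iff]
    constructor
    · exact fun H x hx hxS => H hx (Finset.smul_mem_smul_finset hxS)
    · intro H x hx hxS
      obtain ⟨y, hy, rfl⟩ := Finset.mem_smul_finset.1 hxS
      exact H hx hy
  refine ⟨?_, ?_, ?_⟩
  · rintro ⟨j, A⟩ ⟨hA, hc⟩
    exact ⟨(hdisj A).1 hA, by simpa using hc⟩
  · rintro ⟨j, A⟩ - ⟨j', A'⟩ - heq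
    simpa using heq
  · rintro ⟨j, A⟩ ⟨hA, hc⟩
    exact ⟨(j, h • A), ⟨(hdisj _).2 (by simpa using hA), by simpa using hc⟩, by simp⟩

/-- The action of `h` is additive and bijective and twists scalars by an automorphism of `K`, so it
preserves linear independence. -/
theorem linearIndepOn_transport (hli : LinearIndepOn K e (systemIndex S deg))
    (h : Equiv.Perm Ψ) :
    LinearIndepOn K (fun p : J × Finset Ψ => h • e (p.1, h⁻¹ • p.2))
      (systemIndex (h • S) deg) := by
  have hbij := bijOn_transport (S := S) (deg := deg) h
  have h1 : LinearIndepOn K (e ∘ fun p : J × Finset Ψ => (p.1, h⁻¹ • p.2))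
      (systemIndex (h • S) deg) :=
    LinearIndepOn.comp_of_image (by rwa [hbij.image_eq]) hbij.injOn
  exact LinearIndependent.map_of_injective_injective (R' := K) (M' := V) h1 (fun a => h⁻¹ • a)
    (DistribSMul.toAddMonoidHom V h) (fun r hr => (smul_eq_zero_iff_eq _).1 hr)
    (fun m hm => (smul_eq_zero_iff_eq h).1 hm) fun r m => by
      simp [smul_distrib_smul]

theorem span_transport (hspan : Submodule.span K (e '' systemIndex S deg) = ⊤)
    (h : Equiv.Perm Ψ) :
    Submodule.span K ((fun p : J × Finset Ψ => h • e (p.1, h⁻¹ • p.2)) ''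
      systemIndex (h • S) deg) = ⊤ := by
  rw [eq_top_iff]
  intro v _
  have hv : h⁻¹ • v ∈ Submodule.span K (e '' systemIndex S deg) := hspan ▸ Submodule.mem_top
  rw [← smul_inv_smul h v]
  refine smul_mem_of_mem_span ?_ hv
  rintro _ ⟨p, hp, rfl⟩
  obtain ⟨q, hq, rfl⟩ := (bijOn_transport (S := S) (deg := deg) h).surjOn hp
  exact Submodule.subset_span ⟨q, hq, rfl⟩

/-- The members of a basis system indexed by subsets of `T` form a basis of the space of vectors
fixed by the pointwise stabilizer of `T`. -/
theorem finrank_fixedVectors [Infinite Ψ] [Fintype J] (he : IsEquivariantSystem S e)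
    (hli : LinearIndepOn K e (systemIndex S deg))
    (hspan : Submodule.span K (e '' systemIndex S deg) = ⊤) {T : Finset Ψ} (hST : S ⊆ T) :
    Module.Finite (FixedPoints.subfield (pointwiseStabilizer T) K)
        (fixedVectors K V (pointwiseStabilizer T)) ∧
      Module.finrank (FixedPoints.subfield (pointwiseStabilizer T) K)
        (fixedVectors K V (pointwiseStabilizer T)) =
          ∑ j, (T.card - S.card).choose (deg j) := by
  let ι := Σ j, Finset.powersetCard (deg j) (T \ S)
  have hmem : ∀ i : ι, (i.1, (i.2 : Finset Ψ)) ∈ systemIndex S deg := fun i => by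
    obtain ⟨h1, h2⟩ := Finset.mem_powersetCard.1 i.2.2
    exact ⟨Finset.disjoint_of_subset_left h1 Finset.sdiff_disjoint, h2⟩
  let f : ι → V := fun i => e (i.1, i.2)
  have hf : LinearIndependent K f := by
    refine LinearIndependent.comp hli (fun i : ι => ⟨_, hmem i⟩) ?_
    rintro ⟨j, A, hA⟩ ⟨j', A', hA'⟩ h
    simp only [Subtype.mk.injEq, Prod.mk.injEq] at h
    obtain ⟨rfl, rfl⟩ := h
    rfl
  have hfix : ∀ g ∈ pointwiseStabilizer T, ∀ i, g • f i = f i := by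
    intro g hg i
    simp only [f]
    rw [he g (pointwiseStabilizer_anti hST hg), smul_eq_self_of_mem_pointwiseStabilizer
      ((Finset.mem_powersetCard.1 i.2.2).1.trans Finset.sdiff_subset) hg]
  have heq := fixedVectors_eq_span (K := K) hf hfix fun v hv => ?_
  · rw [heq]
    refine ⟨Module.Finite.span_of_finite _ (Set.finite_range _), ?_⟩
    rw [finrank_span_eq_card (hf.restrict_scalars' _), Fintype.card_sigma]
    simp [Finset.card_sdiff_of_subset hST]
  · have hv' : v ∈ Submodule.span K (Set.range fun p : systemIndex S deg => e p) := by
      rw [← Set.image_eq_range, hspan]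
      exact Submodule.mem_top
    obtain ⟨l, rfl⟩ := Finsupp.mem_span_range_iff_exists_finsupp.1 hv'
    refine Submodule.sum_mem _ fun p hp => Submodule.smul_mem _ _ ?_
    have hpT : p.1.2 ⊆ T := by
      intro y hy
      by_contra hyT
      -- With `z` outside `T` and all sets of the support, swapping `y` and `z` fixes the vector but
      -- moves `p` to an index whose set contains `z` and whose coefficient is nonzero, a
      -- contradiction.
      obtain ⟨z, hz⟩ := Infinite.exists_notMem_finset
        (T ∪ l.support.biUnion fun q => q.1.2)
      rw [Finset.mem_union, not_or] at hz
      let g := Equiv.swap y z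
      have hg : g ∈ pointwiseStabilizer T := swap_mem_pointwiseStabilizer hyT hz.1
      have hgS := pointwiseStabilizer_anti hST hg
      let σ : systemIndex S deg → systemIndex S deg := fun q =>
        ⟨(q.1.1, g • q.1.2), disjoint_smul_of_mem_pointwiseStabilizer q.2.1 hgS, by
          simpa using q.2.2⟩
      have hσ : Function.Injective σ := by
        rintro ⟨⟨j, A⟩, hA⟩ ⟨⟨j', A'⟩, hA'⟩ h
        simpa [σ] using congrArg Subtype.val h
      have h1 := LinearIndependent.coord_smul hli hσ (fun q => he g hgS q.1.1 q.1.2) (hv g hg) p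
      refine hz.2 (Finset.mem_biUnion.2 ⟨σ p, ?_, ?_⟩)
      · rw [Finsupp.mem_support_iff, h1]
        exact fun h0 => Finsupp.mem_support_iff.1 hp ((smul_eq_zero_iff_eq g).1 h0)
      · have h2 : g y = z := Equiv.swap_apply_left _ _
        rw [← h2]
        exact Finset.smul_mem_smul_finset hy
    refine Submodule.subset_span ⟨⟨p.1.1, p.1.2, ?_⟩, rfl⟩
    exact Finset.mem_powersetCard.2
      ⟨Finset.subset_sdiff.2 ⟨hpT, p.2.1⟩, p.2.2⟩

/-- The dimension formula for arbitrary sets of cardinality at least that of `S`. -/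
theorem finrank_fixedVectors_of_card_le [Infinite Ψ] [Fintype J] (he : IsEquivariantSystem S e)
    (hli : LinearIndepOn K e (systemIndex S deg))
    (hspan : Submodule.span K (e '' systemIndex S deg) = ⊤) {T : Finset Ψ}
    (hST : S.card ≤ T.card) :
    Module.Finite (FixedPoints.subfield (pointwiseStabilizer T) K)
        (fixedVectors K V (pointwiseStabilizer T)) ∧
      Module.finrank (FixedPoints.subfield (pointwiseStabilizer T) K)
        (fixedVectors K V (pointwiseStabilizer T)) =
          ∑ j, (T.card - S.card).choose (deg j) := by
  -- A permutation carries `S` onto a subset of `T`; the transported system reduces the claim to the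
  -- case of inclusion.
  obtain ⟨T', hT', hc⟩ := Finset.exists_subset_card_eq hST
  obtain ⟨h, -, hh⟩ := exists_mem_pointwiseStabilizer_smul_eq
    (Finset.disjoint_empty_right S) (Finset.disjoint_empty_right T') hc.symm
  have key := (he.transport h).finrank_fixedVectors (linearIndepOn_transport hli h)
    (span_transport hspan h) (hh ▸ hT')
  rwa [Finset.card_smul_finset] at key

end IsEquivariantSystem

end Dimension

/-! ### The dimension polynomial and the theorem -/

/-- The polynomial whose value at a natural number `m ≥ n` is the binomial coefficient
`(m - n).choose k`. -/
noncomputable def shiftedChoosePolynomial (n k : ℕ) : Polynomial ℚ :=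
  Polynomial.C ((k.factorial : ℚ)⁻¹) *
    (descPochhammer ℚ k).comp (Polynomial.X - Polynomial.C (n : ℚ))

theorem eval_shiftedChoosePolynomial {n m : ℕ} (h : n ≤ m) (k : ℕ) :
    (shiftedChoosePolynomial n k).eval (m : ℚ) = ((m - n).choose k : ℚ) := by
  rw [shiftedChoosePolynomial, Polynomial.eval_mul, Polynomial.eval_C, Polynomial.eval_comp,
    Polynomial.eval_sub, Polynomial.eval_X, Polynomial.eval_C, ← Nat.cast_sub h,
    descPochhammer_eval_eq_descFactorial, Nat.descFactorial_eq_factorial_mul_choose,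
    Nat.cast_mul, inv_mul_cancel_left₀ (Nat.cast_ne_zero.2 (Nat.factorial_ne_zero k))]

theorem mainTheorem12 {Ψ K V : Type*} [Infinite Ψ]
    [Field K] [MulSemiringAction (Equiv.Perm Ψ) K]
    (hK : IsSmoothAction Ψ K) (hK' : IsNontrivialAction (Equiv.Perm Ψ) K)
    [AddCommGroup V] [Module K V] [DistribMulAction (Equiv.Perm Ψ) V]
    [SMulDistribClass (Equiv.Perm Ψ) K V]
    (hV : IsSmoothAction Ψ V) (hV' : IsFinitelyGeneratedRep (Equiv.Perm Ψ) K V) :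
    (∃! P : Polynomial ℚ, ∃ n : ℕ, ∀ T : Finset Ψ, n ≤ T.card →
      Module.Finite (FixedPoints.subfield (pointwiseStabilizer T) K)
        (fixedVectors K V (pointwiseStabilizer T)) ∧
      P.eval (T.card : ℚ) =
        Module.finrank (FixedPoints.subfield (pointwiseStabilizer T) K)
          (fixedVectors K V (pointwiseStabilizer T))) ∧
    (∀ U : Subgroup (Equiv.Perm Ψ), IsOpenSubgroup U →
      Module.Finite (FixedPoints.subfield U K) (fixedVectors K V U)) := by
  classical
  obtain ⟨S₀, J₀, _, deg₀, e₀, he₀, hspan₀⟩ := exists_spanning_system hK hK' hV hV'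
  obtain ⟨N, hN⟩ : ∃ N, ∀ j, deg₀ j < N := by
    obtain ⟨N, hN⟩ := (Set.finite_range deg₀).bddAbove
    exact ⟨N + 1, fun j => Nat.lt_succ_of_le (hN ⟨j, rfl⟩)⟩
  obtain ⟨S, -, J, _, deg, e, he, hli, hspan⟩ := he₀.exists_linearIndepOn (K := K) hN
  rw [hspan₀] at hspan
  have := Fintype.ofFinite J
  have hdim := fun (T : Finset Ψ) (hT : S.card ≤ T.card) =>
    he.finrank_fixedVectors_of_card_le hli hspan hT
  refine ⟨⟨∑ j, shiftedChoosePolynomial S.card (deg j), ⟨S.card, fun T hT => ⟨(hdim T hT).1, ?_⟩⟩,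
    ?_⟩, fun U hU => ?_⟩
  · rw [(hdim T hT).2, Polynomial.eval_finsetSum, Nat.cast_sum]
    exact Finset.sum_congr rfl fun j _ => eval_shiftedChoosePolynomial hT _
  · rintro Q ⟨n, hn⟩
    -- Both polynomials give the dimension at every integer from `max n #S` on, as `Ψ` has finite
    -- subsets of every cardinality.
    refine Polynomial.eq_of_infinite_eval_eq _ _ (Set.Infinite.mono ?_
      ((Set.Ici_infinite (max n S.card)).image (Nat.cast_injective (R := ℚ)).injOn))
    rintro _ ⟨m, hm, rfl⟩
    obtain ⟨T, rfl⟩ := Infinite.exists_subset_card_eq Ψ m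
    have hm' : max n S.card ≤ T.card := hm
    have hS := (le_max_right _ _).trans hm'
    change Q.eval (T.card : ℚ) = Polynomial.eval (T.card : ℚ) _
    rw [(hn T ((le_max_left _ _).trans hm')).2, (hdim T hS).2, Polynomial.eval_finsetSum,
      Nat.cast_sum]
    exact Finset.sum_congr rfl fun j _ => (eval_shiftedChoosePolynomial hS _).symm
  -- An open `U` contains the pointwise stabilizer of some `T ∪ S`, where finiteness is known, and
  -- finiteness passes to larger subgroups.
  · obtain ⟨T, hT⟩ := exists_pointwiseStabilizer_le_of_isOpenSubgroup hU
    have hTS := pointwiseStabilizer_anti (Finset.subset_union_left (s₁ := T) (s₂ := S))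
    have := (hdim (T ∪ S) (Finset.card_le_card Finset.subset_union_right)).1
    exact finite_fixedVectors_of_le (hTS.trans hT)
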